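/- **Setting.** A server holds $N$ files $W_1,\dots,W_N$ of $F$ bits each, independent and uniformly distributed, and is connected to $K$ users by an error-free shared link, with $N\ge K$. User $k$ has a cache of $M_kF$ bits, where $M_k=N m_k$, and $\bm m=(m_1,\dots,m_K)\in[0,1]^K$ is the vector of normalized cache sizes. Write $[K]=\{1,\dots,K\}$. *Uncoded placement.* Let $$\mathfrak A(\bm m)=\Big\{\bm a\in[0,1]^{2^{[K]}}:\ \sum_{\mathcal S\subseteq[K]}a_{\mathcal S}=1,\quad \sum_{\mathcal S\ni k}a_{\mathcal S}\le m_k\ \ \forall k\in[K]\Big\}.$$ An uncoded placement for file size $F$ chooses some $\bm a\in\mathfrak A(\bm m)$ and partitions every file $W_l$ into subfiles $\tilde W_{l,\mathcal S}$, $\mathcal S\subseteq[K]$, where $\tilde W_{l,\mathcal S}$ consists of $a_{\mathcal S}F$ bits of $W_l$ for every $l$ and is stored exactly at the users in $\mathcal S$. The cache content $Z_k$ of user $k$ consists of all $\tilde W_{l,\mathcal S}$ with $k\in\mathcal S$. *Delivery.* For a demand $\bm d\in[N]^K$ the server sends, for each nonempty $\mathcal T\subseteq[K]$, a signal $X_{\mathcal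 T,\bm d}$ with values in a set of size $2^{\lfloor v_{\mathcal T,\bm d}F\rfloor}$, where $v_{\mathcal T,\bm d}\ge0$; the signal is an arbitrary function of $(W_{d_1},\dots,W_{d_K})$. User $k$ forms an estimate $\hat W_{d_k}$ of $W_{d_k}$, an arbitrary function of all the signals and of $Z_k$. The delivery load for the demand $\bm d$ is $\sum_{\mathcal T}v_{\mathcal T,\bm d}$. A load $R$ is *achievable with uncoded placement* if for every $\epsilon>0$ and all sufficiently large $F$ there are an uncoded placement and a delivery scheme whose load is at most $R$ for every demand $\bm d$ and for which $\Pr(\hat W_{d_k}\ne W_{d_k})\le\epsilon$ for all $\bm d$ and all $k$. Let $R^*_{\mathfrak A}(\bm m)$ be the infimum of the loads achievable with uncoded placement. **Theorem (uncoded placement bound).** Let $N\ge K$ and $\bm m\in[0,1]^K$. Let $\mathcal P_{[K]}$ be the set of permutations $\bm q=[q_1,\dots,q_K]$ of $[K]$. For weights $(\alpha_{\bm q})_{\bm q\in\mathcal P_{[K]}}$ and $\mathcal S\subseteq[K]$, put $$\gamma_{\mathcal S}=\begin{cases}K,&\mathcal S=\emptyset,\\ 0,&\mathcal S=[K],\\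 \displaystyle\sum_{j=1}^{K-|\mathcal S|}\ \sum_{\substack{\bm q\in\mathcal P_{[K]}:\ q_{j+1}\in\mathcal S,\\ \{q_1,\dots,q_j\}\cap\mathcal S=\emptyset}} j\,\alpha_{\bm q},&\text{otherwise.}\end{cases}$$ Then the linear program $$\begin{aligned}\max_{\lambda_0\in\mathbb R,\ \lambda_k\ge0,\ \alpha_{\bm q}\ge0}\quad&-\lambda_0-\sum_{k=1}^K m_k\lambda_k\\ \text{subject to}\quad&\lambda_0+\sum_{k\in\mathcal S}\lambda_k+\gamma_{\mathcal S}\ge0\quad\forall\,\mathcal S\subseteq[K],\qquad \sum_{\bm q\in\mathcal P_{[K]}}\alpha_{\bm q}=1\end{aligned}$$ attains its maximum, and $R^*_{\mathfrak A}(\bm m)$ is at least this maximum. -/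

import Mathlib

/-!
Coded caching with `K` users, a library of `N` files of `F` bits each, and caches of sizes
`M k * F = N * m k * F` bits, where `m` is the vector of normalized cache sizes.
-/

namespace CodedCaching

/-- The library: `N` files of `F` bits. -/
abbrev Library (N F : ℕ) : Type := Fin N → Fin F → Bool

/-- A demand vector: user `k` requests the file `d k`. -/
abbrev Demand (K N : ℕ) : Type := Fin K → Fin N

/-- The set `𝔄(m)` of uncoded allocations: `a S` is the fraction of each file that is stored
exclusively at the users in `S`. -/
def allocations {K : ℕ} (m : Fin K → ℝ) : Set (Finset (Fin K) → ℝ) :=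
  {a | (∀ S, a S ∈ Set.Icc (0 : ℝ) 1) ∧ ∑ S, a S = 1 ∧
    ∀ k, ∑ S with k ∈ S, a S ≤ m k}

/-- An uncoded placement for files of `F` bits: bit `i` of file `l` is stored exactly at the users
in `label l i`, so that the subfile of `l` labeled by `S` consists of the bits with label `S`.
For some allocation `a ∈ 𝔄(m)`, that subfile has `a S * F` bits, for every file `l`. -/
structure UncodedPlacement (K N F : ℕ) (m : Fin K → ℝ) where
  label : Fin N → Fin F → Finset (Fin K)
  alloc : Finset (Fin K) → ℝ
  alloc_mem : alloc ∈ allocations m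
  card_subfile : ∀ l S, ((Finset.univ.filter fun i => label l i = S).card : ℝ) = alloc S * F

variable {K N F : ℕ} {m : Fin K → ℝ}

/-- The possible cache contents of user `k`: one bit for each cached position of the library. -/
abbrev UncodedPlacement.Cache (P : UncodedPlacement K N F m) (k : Fin K) : Type :=
  {p : Fin N × Fin F // k ∈ P.label p.1 p.2} → Bool

/-- The content `Z k` of the cache of user `k` when the library is `W`. -/
def UncodedPlacement.cache (P : UncodedPlacement K N F m) (k : Fin K) (W : Library N F) :
    P.Cache k :=
  fun p => W p.1.1 p.1.2

/-- The nonempty sets of users, to which signals are sent. -/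
abbrev Receivers (K : ℕ) : Type := {T : Finset (Fin K) // T.Nonempty}

/-- An arbitrary (not necessarily linear) delivery scheme for a placement `P`. For the demand `d`,
the signal sent to `T` is a function of the requested files with `2 ^ ⌊v d T * F⌋` values; user `k`
estimates its file from all the signals and its own cache. -/
structure DeliveryScheme (P : UncodedPlacement K N F m) where
  v : Demand K N → Receivers K → ℝ
  v_nonneg : ∀ d T, 0 ≤ v d T
  encode : ∀ (d : Demand K N) (T : Receivers K),
    (Fin K → Fin F → Bool) → Fin (2 ^ ⌊v d T * F⌋₊)
  decode : ∀ (d : Demand K N) (k : Fin K),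
    (∀ T : Receivers K, Fin (2 ^ ⌊v d T * F⌋₊)) → P.Cache k → (Fin F → Bool)

namespace DeliveryScheme

variable {P : UncodedPlacement K N F m}

/-- The delivery load `∑ T, v T` for the demand `d`, in units of `F` bits. -/
noncomputable def load (D : DeliveryScheme P) (d : Demand K N) : ℝ := ∑ T, D.v d T

/-- The estimate of its requested file that user `k` forms. -/
def estimate (D : DeliveryScheme P) (d : Demand K N) (k : Fin K) (W : Library N F) :
    Fin F → Bool :=
  D.decode d k (fun T => D.encode d T fun j => W (d j)) (P.cache k W)

/-- The probability, for a uniformly distributed library, that user `k` decodes wrongly. -/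
noncomputable def errorProb (D : DeliveryScheme P) (d : Demand K N) (k : Fin K) : ℝ :=
  ((Finset.univ.filter fun W : Library N F => D.estimate d k W ≠ W (d k)).card : ℝ) /
    (Fintype.card (Library N F) : ℝ)

end DeliveryScheme

/-- The worst-case delivery load `R` is achievable with uncoded placement: for every `ε > 0` and
all large enough file sizes `F`, some uncoded placement and some delivery scheme have load at most
`R` and error probability at most `ε` at every user, for every demand. -/
def Achievable (K N : ℕ) (m : Fin K → ℝ) (R : ℝ) : Prop :=
  ∀ ε : ℝ, 0 < ε → ∃ F₀ : ℕ, ∀ F : ℕ, F₀ ≤ F →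
    ∃ (P : UncodedPlacement K N F m) (D : DeliveryScheme P),
      (∀ d, D.load d ≤ R) ∧ ∀ d k, D.errorProb d k ≤ ε

/-- The minimum worst-case delivery load with uncoded placement. -/
noncomputable def minLoad (K N : ℕ) (m : Fin K → ℝ) : ℝ :=
  sInf {R | Achievable K N m R}

/-- The coefficients `γ S` of the linear program, for weights `α` on the permutations of the users.
Positions in a permutation are counted from `0`, so `q j` is the user in place `j + 1`. -/
noncomputable def gam (α : Equiv.Perm (Fin K) → ℝ) (S : Finset (Fin K)) : ℝ :=
  if S = ∅ then (K : ℝ)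
  else if S = Finset.univ then 0
  else ∑ j : Fin K with 1 ≤ j.val ∧ j.val ≤ K - S.card,
    ∑ q : Equiv.Perm (Fin K) with q j ∈ S ∧ ∀ i, i < j → q i ∉ S, (j.val : ℝ) * α q

/-- Feasible points of the linear program. -/
structure LPFeasible (lam₀ : ℝ) (lam : Fin K → ℝ) (α : Equiv.Perm (Fin K) → ℝ) : Prop where
  lam_nonneg : ∀ k, 0 ≤ lam k
  weight_nonneg : ∀ q, 0 ≤ α q
  weight_sum : ∑ q, α q = 1
  constraint : ∀ S : Finset (Fin K), 0 ≤ lam₀ + ∑ k ∈ S, lam k + gam α S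

/-- The values of the objective of the linear program at its feasible points. -/
def lpValues (m : Fin K → ℝ) : Set ℝ :=
  {x | ∃ (lam₀ : ℝ) (lam : Fin K → ℝ) (α : Equiv.Perm (Fin K) → ℝ),
    LPFeasible lam₀ lam α ∧ x = -lam₀ - ∑ k, m k * lam k}


/-- Sending each user its file uncoded, with empty caches, shows that load `K` is achievable. -/
theorem achievable_card (K N : ℕ) (m : Fin K → ℝ) (hm : ∀ k, 0 ≤ m k) :
    Achievable K N m K := by
  classical
  intro ε hε
  refine ⟨0, fun F _ => ?_⟩
  have halloc : (fun S => if S = ∅ then (1 : ℝ) else 0) ∈ allocations m := by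
    refine ⟨fun S => ?_, ?_, fun k => ?_⟩
    · by_cases h : S = ∅ <;> simp [h]
    · simp
    · rw [Finset.sum_eq_zero]
      · exact hm k
      · intro S hS
        have hS' : k ∈ S := by simpa using hS
        have : S ≠ ∅ := by rintro rfl; simp at hS'
        simp [this]
  let P : UncodedPlacement K N F m :=
    { label := fun _ _ => ∅
      alloc := fun S => if S = ∅ then 1 else 0
      alloc_mem := halloc
      card_subfile := by
        intro l S
        by_cases h : S = ∅
        · simp [h]
        · simp [h, Ne.symm h] }
  let v : Demand K N → Receivers K → ℝ := fun _ T => if T.1.card = 1 then 1 else 0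
  have hv : ∀ d T, T.1.card = 1 → ⌊v d T * F⌋₊ = F := by
    intro d T h
    simp [v, h]
  have he : ∀ d T, T.1.card = 1 → Nonempty ((Fin F → Bool) ≃ Fin (2 ^ ⌊v d T * F⌋₊)) := by
    intro d T h
    rw [hv d T h]
    exact ⟨Fintype.equivFinOfCardEq (by simp)⟩
  let D : DeliveryScheme P :=
    { v := v
      v_nonneg := by intro d T; simp only [v]; split_ifs <;> simp
      encode := fun d T W =>
        if h : T.1.card = 1 then (he d T h).some (W (T.1.min' T.2)) else ⟨0, by positivity⟩
      decode := fun d k X _ =>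
        (he d ⟨{k}, by simp⟩ (by simp)).some.symm (X ⟨{k}, by simp⟩) }
  refine ⟨P, D, fun d => ?_, fun d k => ?_⟩
  · have h1 : D.load d = ∑ T : Finset (Fin K) with T.card = 1, (1 : ℝ) := by
      simp only [DeliveryScheme.load, D, v, Finset.sum_boole, Finset.sum_const, nsmul_eq_mul,
        mul_one]
      congr 1
      refine Finset.card_bij (fun T _ => T.1) (by simp) (fun a _ b _ h => Subtype.ext h) ?_
      intro T hT
      have hT' : T.card = 1 := by simpa using hT
      exact ⟨⟨T, Finset.card_pos.1 (by omega)⟩, by simpa using hT', rfl⟩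
    rw [h1]
    simp
  · have : ∀ W, D.estimate d k W = W (d k) := by
      intro W
      simp [DeliveryScheme.estimate, D]
    simp [DeliveryScheme.errorProb, this, hε.le]

/-- Achievable loads are nonnegative. -/
theorem Achievable.nonneg {K N : ℕ} (hN : K ≤ N) {m : Fin K → ℝ} {R : ℝ}
    (h : Achievable K N m R) : 0 ≤ R := by
  obtain ⟨F₀, h⟩ := h 1 one_pos
  obtain ⟨P, D, h, -⟩ := h F₀ le_rfl
  exact (Finset.sum_nonneg fun T _ => D.v_nonneg (Fin.castLE hN) T).trans (h (Fin.castLE hN))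

/-- For `K ≤ N`, the value `minLoad K N m` is a genuine infimum. -/
theorem isGLB_minLoad {K N : ℕ} (hN : K ≤ N) {m : Fin K → ℝ} (hm : ∀ k, 0 ≤ m k) :
    IsGLB {R | Achievable K N m R} (minLoad K N m) :=
  isGLB_csInf ⟨_, achievable_card K N m hm⟩ ⟨0, fun _ h => h.nonneg hN⟩

end CodedCaching

/-!
The lower bound is a counting argument combined with weak LP duality.

Fix a permutation `q` of the users and a demand `d` for distinct files. Call a bit *hidden* if it
belongs to a file `d (q j)` and is cached by none of `q 0, …, q j`. Given the signals and all bits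
that are not hidden, the requested files can be recovered in the order `d (q 0), d (q 1), …`: every
cached bit of user `q j` either is not hidden or lies in a file that has already been recovered.
Hence the libraries that all users decode correctly inject into pairs of signals and non-hidden
bits. If these libraries make up at least half of all libraries, the signals carry all hidden bits
up to one (`card_hiddenBits_le`), and the library has `F * ∑ S, a S * numBeforeHit q S` hidden
bits (`card_hiddenBits`), where `numBeforeHit q S` counts the users in front of the first member
of `S` in the order `q`. As `F → ∞`, a single bit does not matter.

Since `gam α S` is at most the `α`-average of `numBeforeHit q S`, averaging these bounds over `q`
and using the constraints of the linear program together with `a ∈ 𝔄(m)` bounds every achievable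
load below by every value of the program (`lpValue_le_of_achievable`).

The maximum is attained because every feasible point is matched or beaten by one in a compact set:
multipliers `lam k` above `K` can be lowered to `K`, and a point with `lam₀ > 0` has a negative
value, while the value `0` occurs (`exists_isGreatest_lpValues`).
-/

namespace CodedCaching

open Finset

variable {K N F : ℕ} {m : Fin K → ℝ}

/-! ### The coefficients of the linear program -/

/-- The number of users that precede the first member of `S` in the order `q`; it is `K` if `S` is
empty. -/
def numBeforeHit (q : Equiv.Perm (Fin K)) (S : Finset (Fin K)) : ℕ :=
  #{j | ∀ i ≤ j, q i ∉ S}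

theorem numBeforeHit_empty (q : Equiv.Perm (Fin K)) : numBeforeHit q ∅ = K := by
  simp [numBeforeHit]

theorem numBeforeHit_eq_of_first_mem {q : Equiv.Perm (Fin K)} {S : Finset (Fin K)} {j : Fin K}
    (hj : q j ∈ S) (hlt : ∀ i < j, q i ∉ S) : numBeforeHit q S = j := by
  have : ({j | ∀ i ≤ j, q i ∉ S} : Finset (Fin K)) = Iio j := by
    ext l
    simp only [mem_filter, mem_univ, true_and, mem_Iio]
    exact ⟨fun h => not_le.1 fun hl => h j hl hj, fun h i hi => hlt i (hi.trans_lt h)⟩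
  rw [numBeforeHit, this, Fin.card_Iio]

/-- The coefficient `gam α S` is at most the average number of users in front of the first member
of `S`. Equality holds too, but weak duality needs only this direction. -/
theorem gam_le {α : Equiv.Perm (Fin K) → ℝ} (hα : ∀ q, 0 ≤ α q) (hsum : ∑ q, α q = 1)
    (S : Finset (Fin K)) : gam α S ≤ ∑ q, α q * numBeforeHit q S := by
  have hnonneg : ∀ q, 0 ≤ α q * numBeforeHit q S := fun q => mul_nonneg (hα q) (Nat.cast_nonneg _)
  unfold gam
  split_ifs with h₁ h₂
  · subst h₁
    simp [numBeforeHit_empty, ← sum_mul, hsum]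
  · exact sum_nonneg fun q _ => hnonneg q
  · simp_rw [sum_filter (s := (univ : Finset (Equiv.Perm (Fin K))))]
    rw [sum_comm]
    refine sum_le_sum fun q _ => ?_
    by_cases h : ∃ j, q j ∈ S ∧ ∀ i < j, q i ∉ S
    · obtain ⟨j, hj⟩ := h
      have huniq : ∀ l, l ≠ j → ¬(q l ∈ S ∧ ∀ i < l, q i ∉ S) := by
        rintro l hl ⟨hl₁, hl₂⟩
        rcases lt_or_gt_of_ne hl with h | h
        · exact hj.2 l h hl₁
        · exact hl₂ j h hj.1
      rw [numBeforeHit_eq_of_first_mem hj.1 hj.2, mul_comm]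
      calc _ ≤ ∑ l : Fin K, (if q l ∈ S ∧ ∀ i < l, q i ∉ S then (l : ℝ) * α q else 0) :=
            sum_le_sum_of_subset_of_nonneg (filter_subset _ _) fun l _ _ => by
              split_ifs
              · exact mul_nonneg (Nat.cast_nonneg _) (hα q)
              · exact le_rfl
        _ = (j : ℝ) * α q := by
            rw [sum_eq_single j (fun l _ hl => if_neg (huniq l hl)) (by simp), if_pos hj]
    · rw [sum_eq_zero fun l _ => if_neg fun hl => h ⟨l, hl⟩]
      exact hnonneg q

/-! ### Attainment of the maximum -/

theorem gam_nonneg {α : Equiv.Perm (Fin K) → ℝ} (hα : ∀ q, 0 ≤ α q) (S : Finset (Fin K)) :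
    0 ≤ gam α S := by
  unfold gam
  split_ifs
  · positivity
  · exact le_rfl
  · exact sum_nonneg fun j _ => sum_nonneg fun q _ => mul_nonneg (Nat.cast_nonneg _) (hα q)

theorem continuous_gam (S : Finset (Fin K)) :
    Continuous fun α : Equiv.Perm (Fin K) → ℝ => gam α S := by
  unfold gam
  split_ifs <;> fun_prop

theorem LPFeasible.neg_card_le {lam₀ : ℝ} {lam : Fin K → ℝ} {α : Equiv.Perm (Fin K) → ℝ}
    (h : LPFeasible lam₀ lam α) : -(K : ℝ) ≤ lam₀ := by
  have := h.constraint ∅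
  simp [gam] at this
  linarith

/-- Multipliers larger than `K` can be lowered to `K`, since `lam₀ ≥ -K` by the constraint of the
empty set. -/
theorem LPFeasible.truncate {lam₀ : ℝ} {lam : Fin K → ℝ} {α : Equiv.Perm (Fin K) → ℝ}
    (h : LPFeasible lam₀ lam α) : LPFeasible lam₀ (fun k => min (lam k) K) α where
  lam_nonneg k := le_min (h.lam_nonneg k) (Nat.cast_nonneg _)
  weight_nonneg := h.weight_nonneg
  weight_sum := h.weight_sum
  constraint S := by
    by_cases hS : ∃ k ∈ S, (K : ℝ) ≤ lam k
    · obtain ⟨k, hk, hle⟩ := hS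
      have h₁ : min (lam k) (K : ℝ) ≤ ∑ k ∈ S, min (lam k) (K : ℝ) :=
        single_le_sum (f := fun k => min (lam k) (K : ℝ))
          (fun l _ => le_min (h.lam_nonneg l) (Nat.cast_nonneg _)) hk
      rw [min_eq_right hle] at h₁
      linarith [h.neg_card_le, gam_nonneg h.weight_nonneg S]
    · push Not at hS
      rw [sum_congr rfl fun k hk => min_eq_left (hS k hk).le]
      exact h.constraint S

theorem exists_isGreatest_lpValues (hm : ∀ k, 0 ≤ m k) : ∃ V, IsGreatest (lpValues m) V := by
  let X := ℝ × (Fin K → ℝ) × (Equiv.Perm (Fin K) → ℝ)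
  let obj : X → ℝ := fun x => -x.1 - ∑ k, m k * x.2.1 k
  let B : Set X := Set.Icc (-(K : ℝ), 0, 0) (0, (fun _ => (K : ℝ)), 1)
  let C : Set X := {x | ∑ q, x.2.2 q = 1} ∩
    ⋂ S, {x | 0 ≤ x.1 + ∑ k ∈ S, x.2.1 k + gam x.2.2 S}
  have hC : IsClosed C := by
    refine (isClosed_eq (by fun_prop) continuous_const).inter (isClosed_iInter fun S => ?_)
    refine isClosed_le continuous_const (Continuous.add (by fun_prop) ?_)
    exact (continuous_gam S).comp (continuous_snd.comp continuous_snd)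
  have hcomp : IsCompact (B ∩ C) := isCompact_Icc.inter_right hC
  -- A point mass at the identity, with all multipliers zero.
  let x₀ : X := (0, 0, Pi.single 1 1)
  have hx₀ : x₀ ∈ B ∩ C := by
    refine ⟨⟨⟨by simp [x₀], le_rfl, ?_⟩, ⟨le_rfl, fun k => by simp [x₀], ?_⟩⟩,
      by simp [x₀], Set.mem_iInter.2 fun S => ?_⟩
    · exact Pi.single_nonneg.2 zero_le_one
    · intro q
      by_cases hq : q = 1
      · subst hq; simp [x₀]
      · simp [x₀, Pi.single_eq_of_ne hq]
    · have : 0 ≤ gam (Pi.single (1 : Equiv.Perm (Fin K)) (1 : ℝ)) S :=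
        gam_nonneg (fun q => by by_cases hq : q = 1 <;> simp [hq]) S
      simpa [x₀] using this
  obtain ⟨x, hx, hmax⟩ := hcomp.exists_isMaxOn (f := obj) ⟨x₀, hx₀⟩
    (by apply Continuous.continuousOn; fun_prop)
  refine ⟨obj x, ⟨x.1, x.2.1, x.2.2, ⟨?_, ?_, hx.2.1, ?_⟩, rfl⟩, ?_⟩
  · exact hx.1.1.2.1
  · exact hx.1.1.2.2
  · exact fun S => Set.mem_iInter.1 hx.2.2 S
  rintro _ ⟨lam₀, lam, α, h, rfl⟩
  -- A point with `lam₀ > 0` has a negative value and is beaten by `x₀`; any other point lies in the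
  -- compact set after truncation.
  by_cases hpos : 0 < lam₀
  · have h₀ : obj x₀ ≤ obj x := hmax hx₀
    have h₁ : 0 ≤ ∑ k, m k * lam k := sum_nonneg fun k _ => mul_nonneg (hm k) (h.lam_nonneg k)
    have h₂ : obj x₀ = 0 := by simp [obj, x₀]
    linarith
  · have ht := h.truncate
    have hy : ((lam₀, (fun k => min (lam k) (K : ℝ)), α) : X) ∈ B ∩ C := by
      refine ⟨⟨⟨h.neg_card_le, ht.lam_nonneg, h.weight_nonneg⟩,
        ⟨not_lt.1 hpos, fun k => min_le_right _ _, fun q => ?_⟩⟩,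
        h.weight_sum, Set.mem_iInter.2 ht.constraint⟩
      have := single_le_sum (fun q _ => h.weight_nonneg q) (mem_univ q)
      rwa [h.weight_sum] at this
    have h₀ : -lam₀ - ∑ k, m k * min (lam k) (K : ℝ) ≤ obj x := hmax hy
    have h₁ : ∑ k, m k * min (lam k) (K : ℝ) ≤ ∑ k, m k * lam k :=
      sum_le_sum fun k _ => mul_le_mul_of_nonneg_left (min_le_left _ _) (hm k)
    linarith

/-! ### Counting the libraries that are decoded correctly -/

/-- The hidden bits for the demand `d` and the order `q` of the users: the bits of a file `d (q j)`
that none of the users `q 0, …, q j` caches. -/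
def UncodedPlacement.hiddenBits (P : UncodedPlacement K N F m) (d : Demand K N)
    (q : Equiv.Perm (Fin K)) : Finset (Fin N × Fin F) :=
  {p | ∃ j, p.1 = d (q j) ∧ ∀ i ≤ j, q i ∉ P.label p.1 p.2}

theorem UncodedPlacement.card_hiddenBits (P : UncodedPlacement K N F m) {d : Demand K N}
    (hd : Function.Injective d) (q : Equiv.Perm (Fin K)) :
    (#(P.hiddenBits d q) : ℝ) = F * ∑ S, P.alloc S * numBeforeHit q S := by
  have himage : P.hiddenBits d q = image (fun x : Fin K × Fin F => (d (q x.1), x.2))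
      {x | ∀ i ≤ x.1, q i ∉ P.label (d (q x.1)) x.2} := by
    ext ⟨l, b⟩
    simp only [hiddenBits, mem_filter, mem_univ, true_and, mem_image, Prod.exists, Prod.mk.injEq]
    constructor
    · rintro ⟨j, rfl, h⟩
      exact ⟨j, b, h, rfl, rfl⟩
    · rintro ⟨j, _, h, rfl, rfl⟩
      exact ⟨j, rfl, h⟩
  have hinj : Function.Injective fun x : Fin K × Fin F => (d (q x.1), x.2) := by
    rintro ⟨j, b⟩ ⟨j', b'⟩ h
    simp only [Prod.mk.injEq] at h
    exact Prod.ext (q.injective (hd h.1)) h.2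
  have hfile : ∀ j, (#{b | ∀ i ≤ j, q i ∉ P.label (d (q j)) b} : ℝ) =
      ∑ S, if ∀ i ≤ j, q i ∉ S then P.alloc S * F else 0 := by
    intro j
    rw [card_eq_sum_card_fiberwise (f := P.label (d (q j))) (t := univ) (by simp)]
    push_cast
    refine sum_congr rfl fun S _ => ?_
    rw [filter_filter]
    split_ifs with h
    · rw [← P.card_subfile (d (q j)) S]
      congr 2
      ext b
      simp only [mem_filter, mem_univ, true_and, and_iff_right_iff_imp]
      rintro rfl
      exact h
    · rw [Nat.cast_eq_zero, card_eq_zero, filter_eq_empty_iff]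
      rintro b _ ⟨h', rfl⟩
      exact h h'
  have hcount : (#{x : Fin K × Fin F | ∀ i ≤ x.1, q i ∉ P.label (d (q x.1)) x.2} : ℝ) =
      ∑ j, (#{b | ∀ i ≤ j, q i ∉ P.label (d (q j)) b} : ℝ) := by
    simp_rw [card_filter]
    rw [Fintype.sum_prod_type]
    push_cast
    rfl
  rw [himage, card_image_of_injective _ hinj, hcount, sum_congr rfl fun j _ => hfile j, sum_comm,
    mul_sum]
  refine sum_congr rfl fun S _ => ?_
  rw [← sum_filter, sum_const, nsmul_eq_mul, numBeforeHit]
  ring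

namespace DeliveryScheme

variable {P : UncodedPlacement K N F m}

/-- Successive decoding: a library that all users decode correctly is determined by the signals and
the bits that are not hidden. -/
theorem eq_of_signals_eq (D : DeliveryScheme P) {d : Demand K N} (q : Equiv.Perm (Fin K))
    {W W' : Library N F} (hW : ∀ k, D.estimate d k W = W (d k))
    (hW' : ∀ k, D.estimate d k W' = W' (d k))
    (hX : ∀ T, (D.encode d T fun j => W (d j)) = D.encode d T fun j => W' (d j))
    (hbits : ∀ p ∉ P.hiddenBits d q, W p.1 p.2 = W' p.1 p.2) : W = W' := by
  have hfile : ∀ j, W (d (q j)) = W' (d (q j)) := by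
    intro j
    induction j using WellFoundedLT.induction with
    | ind j ih =>
    have hcache : P.cache (q j) W = P.cache (q j) W' := by
      funext ⟨p, hp⟩
      change W p.1 p.2 = W' p.1 p.2
      by_cases hU : p ∈ P.hiddenBits d q
      · obtain ⟨j', hj', hnot⟩ := (mem_filter.1 hU).2
        have hlt : j' < j := not_le.1 fun hle => hnot j hle hp
        rw [hj', ih j' hlt]
      · exact hbits p hU
    rw [← hW, ← hW', estimate, estimate, hcache, funext hX]
  funext l b
  by_cases hU : (l, b) ∈ P.hiddenBits d q
  · obtain ⟨j, hj, -⟩ := (mem_filter.1 hU).2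
    simp only at hj
    rw [hj, hfile j]
  · exact hbits (l, b) hU

theorem card_decodable_mul_le (D : DeliveryScheme P) (d : Demand K N) (q : Equiv.Perm (Fin K)) :
    #{W | ∀ k, D.estimate d k W = W (d k)} * 2 ^ #(P.hiddenBits d q) ≤
      Fintype.card (Library N F) * 2 ^ ∑ T, ⌊D.v d T * F⌋₊ := by
  set U := P.hiddenBits d q
  let f : Library N F → ({p // p ∉ U} → Bool) × (∀ T : Receivers K, Fin (2 ^ ⌊D.v d T * F⌋₊)) :=
    fun W => (fun p => W p.1.1 p.1.2, fun T => D.encode d T fun j => W (d j))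
  have hle : #{W | ∀ k, D.estimate d k W = W (d k)} ≤
      2 ^ (N * F - #U) * 2 ^ ∑ T, ⌊D.v d T * F⌋₊ := by
    calc _ ≤ #(univ : Finset (({p // p ∉ U} → Bool) ×
          (∀ T : Receivers K, Fin (2 ^ ⌊D.v d T * F⌋₊)))) := by
          refine card_le_card_of_injOn f (fun _ _ => mem_univ _) fun W hW W' hW' h => ?_
          simp only [coe_filter, mem_univ, true_and, Set.mem_ofPred_eq] at hW hW'
          have h₁ := congrArg Prod.fst h
          have h₂ := congrArg Prod.snd h
          exact D.eq_of_signals_eq q hW hW' (fun T => congrFun h₂ T)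
            fun p hp => congrFun h₁ ⟨p, hp⟩
      _ = _ := by
          have : Fintype.card {p // p ∉ U} = N * F - #U := by
            rw [Fintype.card_subtype_compl]
            simp
          rw [card_univ, Fintype.card_prod, Fintype.card_fun, Fintype.card_pi, this]
          simp [prod_pow_eq_pow_sum]
  have hU : #U ≤ N * F := by simpa using card_le_univ U
  calc _ ≤ 2 ^ (N * F - #U) * 2 ^ (∑ T, ⌊D.v d T * F⌋₊) * 2 ^ #U := Nat.mul_le_mul_right _ hle
    _ = 2 ^ (N * F) * 2 ^ ∑ T, ⌊D.v d T * F⌋₊ := by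
        rw [mul_right_comm, ← pow_add, Nat.sub_add_cancel hU]
    _ = _ := by
        congr 1
        simp [Library, ← pow_mul, mul_comm]

/-- Union bound over the users. -/
theorem card_le_two_mul_card_decodable (D : DeliveryScheme P) {d : Demand K N}
    (herr : ∑ k, D.errorProb d k ≤ 1 / 2) :
    Fintype.card (Library N F) ≤ 2 * #{W | ∀ k, D.estimate d k W = W (d k)} := by
  have hcard : (0 : ℝ) < Fintype.card (Library N F) := by exact_mod_cast Fintype.card_pos
  have hbad : #{W | ¬∀ k, D.estimate d k W = W (d k)} ≤
      ∑ k, #{W | D.estimate d k W ≠ W (d k)} := by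
    refine (card_le_card fun W hW => ?_).trans card_biUnion_le
    simpa using hW
  have herr' : ∑ k, (#{W | D.estimate d k W ≠ W (d k)} : ℝ) ≤
      1 / 2 * Fintype.card (Library N F) := by
    simp only [errorProb] at herr
    rwa [← sum_div, div_le_iff₀ hcard] at herr
  have hsplit : #{W | ∀ k, D.estimate d k W = W (d k)} +
      #{W | ¬∀ k, D.estimate d k W = W (d k)} = Fintype.card (Library N F) :=
    card_filter_add_card_filter_not _
  have hbad' : (#{W | ¬∀ k, D.estimate d k W = W (d k)} : ℝ) ≤
      ∑ k, (#{W | D.estimate d k W ≠ W (d k)} : ℝ) := by exact_mod_cast hbad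
  have hsplit' : (#{W | ∀ k, D.estimate d k W = W (d k)} : ℝ) +
      #{W | ¬∀ k, D.estimate d k W = W (d k)} = Fintype.card (Library N F) := by
    exact_mod_cast hsplit
  have : (Fintype.card (Library N F) : ℝ) ≤ 2 * #{W | ∀ k, D.estimate d k W = W (d k)} := by
    linarith
  exact_mod_cast this

theorem card_hiddenBits_le (D : DeliveryScheme P) {d : Demand K N} (q : Equiv.Perm (Fin K))
    (herr : ∑ k, D.errorProb d k ≤ 1 / 2) :
    #(P.hiddenBits d q) ≤ (∑ T, ⌊D.v d T * F⌋₊) + 1 := by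
  have h₁ := D.card_decodable_mul_le d q
  have h₂ := D.card_le_two_mul_card_decodable herr
  have hpos : 0 < Fintype.card (Library N F) := Fintype.card_pos
  rw [← Nat.pow_le_pow_iff_right (one_lt_two : 1 < 2)]
  refine Nat.le_of_mul_le_mul_left ?_ hpos
  calc _ ≤ 2 * #{W | ∀ k, D.estimate d k W = W (d k)} * 2 ^ #(P.hiddenBits d q) :=
        Nat.mul_le_mul_right _ h₂
    _ = 2 * (#{W | ∀ k, D.estimate d k W = W (d k)} * 2 ^ #(P.hiddenBits d q)) := mul_assoc _ _ _
    _ ≤ 2 * (Fintype.card (Library N F) * 2 ^ ∑ T, ⌊D.v d T * F⌋₊) := Nat.mul_le_mul_left _ h₁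
    _ = _ := by ring

/-- The uncoded converse bound for a single order of the users. -/
theorem sum_alloc_mul_le_load (D : DeliveryScheme P) {d : Demand K N}
    (hd : Function.Injective d) (q : Equiv.Perm (Fin K))
    (herr : ∑ k, D.errorProb d k ≤ 1 / 2) :
    F * ∑ S, P.alloc S * numBeforeHit q S ≤ F * D.load d + 1 := by
  rw [← P.card_hiddenBits hd q]
  have h₁ : (#(P.hiddenBits d q) : ℝ) ≤ (∑ T, (⌊D.v d T * F⌋₊ : ℝ)) + 1 := by
    exact_mod_cast D.card_hiddenBits_le q herr
  have h₂ : ∑ T, (⌊D.v d T * F⌋₊ : ℝ) ≤ ∑ T, D.v d T * F :=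
    sum_le_sum fun T _ => Nat.floor_le (mul_nonneg (D.v_nonneg d T) (Nat.cast_nonneg _))
  rw [← sum_mul] at h₂
  rw [load, mul_comm]
  linarith

end DeliveryScheme

/-! ### Weak duality -/

/-- Weak duality: a common bound for all orders of the users, for a fixed allocation, bounds all
values of the linear program. -/
theorem LPFeasible.value_le {lam₀ : ℝ} {lam : Fin K → ℝ} {α : Equiv.Perm (Fin K) → ℝ}
    (h : LPFeasible lam₀ lam α) {a : Finset (Fin K) → ℝ} (ha : a ∈ allocations m) {c : ℝ}
    (hc : ∀ q, ∑ S, a S * numBeforeHit q S ≤ c) : -lam₀ - ∑ k, m k * lam k ≤ c := by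
  obtain ⟨ha₀, ha₁, ham⟩ := ha
  have hcache : ∑ S, a S * ∑ k ∈ S, lam k ≤ ∑ k, m k * lam k := by
    calc ∑ S, a S * ∑ k ∈ S, lam k = ∑ S, ∑ k, if k ∈ S then a S * lam k else 0 := by
          refine sum_congr rfl fun S _ => ?_
          rw [mul_sum, ← sum_filter]
          simp
      _ = ∑ k, (∑ S with k ∈ S, a S) * lam k := by
          rw [sum_comm]
          refine sum_congr rfl fun k _ => ?_
          rw [sum_mul, sum_filter]
      _ ≤ _ := sum_le_sum fun k _ => mul_le_mul_of_nonneg_right (ham k) (h.lam_nonneg k)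
  have hgam : ∑ S, a S * gam α S ≤ c := by
    calc ∑ S, a S * gam α S ≤ ∑ S, a S * ∑ q, α q * numBeforeHit q S :=
          sum_le_sum fun S _ =>
            mul_le_mul_of_nonneg_left (gam_le h.weight_nonneg h.weight_sum S) (ha₀ S).1
      _ = ∑ q, α q * ∑ S, a S * numBeforeHit q S := by
          simp_rw [mul_sum]
          rw [sum_comm]
          exact sum_congr rfl fun q _ => sum_congr rfl fun S _ => mul_left_comm _ _ _
      _ ≤ ∑ q, α q * c :=
          sum_le_sum fun q _ => mul_le_mul_of_nonneg_left (hc q) (h.weight_nonneg q)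
      _ = c := by rw [← sum_mul, h.weight_sum, one_mul]
  have hconstr : 0 ≤ ∑ S, a S * (lam₀ + ∑ k ∈ S, lam k + gam α S) :=
    sum_nonneg fun S _ => mul_nonneg (ha₀ S).1 (h.constraint S)
  simp_rw [mul_add] at hconstr
  rw [sum_add_distrib, sum_add_distrib, ← sum_mul, ha₁] at hconstr
  linarith

theorem lpValue_le_of_achievable (hN : K ≤ N) {R x : ℝ} (hR : Achievable K N m R)
    (hx : x ∈ lpValues m) : x ≤ R := by
  obtain ⟨lam₀, lam, α, h, rfl⟩ := hx
  -- With this error probability, the union bound over `K` users stays below `1 / 2`.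
  have hε : (0 : ℝ) < 1 / (2 * (K + 1)) := by positivity
  obtain ⟨F₀, hF₀⟩ := hR _ hε
  refine le_of_forall_pos_le_add fun δ hδ => ?_
  obtain ⟨n, hn⟩ := exists_nat_one_div_lt hδ
  obtain ⟨F, hF, hnF⟩ : ∃ F, F₀ ≤ F ∧ n + 1 ≤ F := ⟨_, le_max_left _ _, le_max_right _ _⟩
  obtain ⟨P, D, hload, herr⟩ := hF₀ F hF
  have hFn : (n : ℝ) + 1 ≤ F := by exact_mod_cast hnF
  have hFpos : (0 : ℝ) < F := lt_of_lt_of_le (by positivity) hFn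
  refine h.value_le P.alloc_mem fun q => ?_
  have herr' : ∑ k, D.errorProb (Fin.castLE hN) k ≤ 1 / 2 := by
    calc _ ≤ ∑ _k : Fin K, (1 : ℝ) / (2 * (K + 1)) := sum_le_sum fun k _ => herr _ k
      _ = K / (2 * (K + 1)) := by simp [div_eq_mul_inv]
      _ ≤ 1 / 2 := by
          rw [div_le_div_iff₀ (by positivity) two_pos]
          linarith
  have hq := D.sum_alloc_mul_le_load (Fin.castLE_injective hN) q herr'
  have hδF : 1 ≤ F * δ := by
    have : 1 < δ * (n + 1) := (div_lt_iff₀ (by positivity)).1 hn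
    nlinarith
  have hRF : F * D.load (Fin.castLE hN) ≤ F * R := mul_le_mul_of_nonneg_left (hload _) hFpos.le
  refine le_of_mul_le_mul_left ?_ hFpos
  linarith [mul_add (F : ℝ) R δ]

end CodedCaching

/-- The linear program attains its maximum, and the minimum worst-case delivery load with uncoded
placement is at least that maximum. -/
theorem mainTheorem1 (K N : ℕ) (hN : K ≤ N) (m : Fin K → ℝ)
    (hm : ∀ k, m k ∈ Set.Icc (0 : ℝ) 1) :
    ∃ V : ℝ, IsGreatest (CodedCaching.lpValues m) V ∧ V ≤ CodedCaching.minLoad K N m := by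
  obtain ⟨V, hV⟩ := CodedCaching.exists_isGreatest_lpValues fun k => (hm k).1
  exact ⟨V, hV, (CodedCaching.isGLB_minLoad hN fun k => (hm k).1).2 fun _ hR =>
    CodedCaching.lpValue_le_of_achievable hN hR hV.1⟩
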